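/- **Setting.** Let $\pi=(n_1,\dots,n_m)$, $m\ge 2$, $n_r\ge 1$, $n_1+\dots+n_m=n$, be a partition of $n$. It splits every $n\times n$ matrix $A$ into blocks $A_{rs}\in\mathbb C^{n_r\times n_s}$. Let $\mathrm{off}(A)=\|A-\mathrm{diag}(A)\|_F$, where $\mathrm{diag}(A)$ is the diagonal part of $A$. *Pivot orderings.* Let $\mathcal P_m=\{(r,s): 1\le r<s\le m\}$ and $M=m(m-1)/2$. A pivot ordering is a sequence $\mathcal O=(i_0,j_0),\dots,(i_{M-1},j_{M-1})$ in which each element of $\mathcal P_m$ appears exactly once. Its cyclic pivot strategy $I_{\mathcal O}$ uses the pivot pair $(i_{k \bmod M},j_{k\bmod M})$ in step $k\ge 0$. Two orderings are *equivalent* if one arises from the other by finitely many transpositions of adjacent pairs $(i,j),(i',j')$ with $\{i,j\}\cap\{i',j'\}=\emptyset$; *shift equivalent* if they are concatenations $[\mathcal O_1,\mathcal O_2]$ and $[\mathcal O_2,\mathcal O_1]$ of the same two sequences; *weakly equivalent* if they are joined by a finite chain of orderings in which neighbours are equivalent or shift equivalent; *permutation equivalent* if one arises from the other by applying a permutation of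 $\{1,\dots,m\}$ to all indices, where the positions $(r,s)$ and $(s,r)$ are identified. Let $\mathcal B_{sp}^{(m)}$ be the set of the pivot orderings that take the columns $2,3,\dots,m$ of $\mathcal P_m$ one after another, the pairs $(i,j)$, $i<j$, of column $j$ in any order; of those that take the rows $m-1,m-2,\dots,1$ one after another, the pairs $(i,j)$, $j>i$, of row $i$ in any order; and of the reverses of all these. A pivot ordering $\mathcal O$ is *generalized serial* if there are $\mathcal O''\in\mathcal B_{sp}^{(m)}$ and an ordering $\mathcal O'$ such that either $\mathcal O,\mathcal O'$ are permutation equivalent and $\mathcal O',\mathcal O''$ are weakly equivalent, or $\mathcal O,\mathcal O'$ are weakly equivalent and $\mathcal O',\mathcal O''$ are permutation equivalent. Such a connection is a *chain in the canonical form*; the chain realizing its weak equivalence contains some number $d\ge 0$ of shift equivalences. *Transformations.* A unitary elementary block matrix with pivot pair $(i,j)$ is a unitary $U\in\mathbb C^{n\times n}$ that differs from $I_n$ at most in the blocks $U_{ii},U_{ij},U_{ji},U_{jj}$. For $0<\varrho\le 1$ it belongs to $\mathrm{UBCE}_\pi(\varrho)$ if $$\sigma_{\min}(U_{ii})=\sigma_{\min}(U_{jj})\ge\varrho\,\gamma_{ij},\qquad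 \gamma_{ij}=\max\left\{\frac{3}{\sqrt{(n_j+1)(4^{n_i}+6n_j-1)}},\ \binom{n_i+n_j}{n_i}^{-1/2}\right\}.$$ *Method.* The cyclic complex block Jacobi method with strategy $I_{\mathcal O}$ generates from a Hermitian matrix $A=A^{(0)}$ the matrices $A^{(k+1)}=(U^{(k)})^*A^{(k)}U^{(k)}$, $k\ge 0$, where $U^{(k)}$ is a unitary elementary block matrix with the pivot pair $(i,j)$ of step $k$ such that $(\widehat U^{(k)})^*\widehat A^{(k)}\widehat U^{(k)}$ is diagonal; here $\widehat X=\begin{bmatrix}X_{ii}&X_{ij}\\X_{ji}&X_{jj}\end{bmatrix}$. A sweep consists of $M$ successive steps. **Theorem.** For all $n$ and all $0<\varrho\le 1$ there is a constant $\widetilde\mu_{n,\varrho}<1$ that depends only on $n$ and $\varrho$, and for each partition $\pi=(n_1,\dots,n_m)$ of $n$ with $m\ge 2$ there is a constant $\mu_{\pi,\varrho}$ that depends only on $\pi$ and $\varrho$, with $$0\le\mu_{\pi,\varrho}<\widetilde\mu_{n,\varrho}<1,$$ such that the following holds. Let $\mathcal O$ be a generalized serial pivot ordering for which a chain in the canonical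 form connecting $\mathcal O$ with some $\mathcal O''\in\mathcal B_{sp}^{(m)}$ contains $d$ shift equivalences. Let $A\in\mathbb C^{n\times n}$ be Hermitian, and let $A'=A^{((d+1)M)}$ be obtained from $A$ by $d+1$ sweeps of the cyclic block Jacobi method with strategy $I_{\mathcal O}$, starting at step $0$, in which all transformation matrices $U^{(k)}$ belong, with their pivot pairs, to $\mathrm{UBCE}_\pi(\varrho)$. Then $$\mathrm{off}(A')\le\mu_{\pi,\varrho}\,\mathrm{off}(A).$$ -/

import Mathlib

open scoped Matrix

namespace BlockJacobi

section Orderings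

variable {m : ℕ}

/-- A pivot ordering of `P_m = {(r, s) | r < s}`: a finite sequence in which every pivot pair
appears exactly once (block indices are counted from `0`). -/
structure IsPivotOrdering (O : List (Fin m × Fin m)) : Prop where
  nodup : O.Nodup
  mem_iff : ∀ p : Fin m × Fin m, p ∈ O ↔ p.1 < p.2

/-- `O'` arises from `O` by one admissible transposition: two adjacent pairs
whose index sets are disjoint are swapped. -/
def AdmissibleTransposition (O O' : List (Fin m × Fin m)) : Prop :=
  ∃ (L R : List (Fin m × Fin m)) (p q : Fin m × Fin m),
    Disjoint ({p.1, p.2} : Set (Fin m)) {q.1, q.2} ∧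
      O = L ++ p :: q :: R ∧ O' = L ++ q :: p :: R

/-- Equivalence of orderings: finitely many admissible transpositions. -/
def OrdEquiv (O O' : List (Fin m × Fin m)) : Prop :=
  Relation.ReflTransGen AdmissibleTransposition O O'

/-- Shift equivalence: `O = [O₁, O₂]` and `O' = [O₂, O₁]`. -/
def ShiftEquiv (O O' : List (Fin m × Fin m)) : Prop :=
  ∃ O₁ O₂ : List (Fin m × Fin m), O = O₁ ++ O₂ ∧ O' = O₂ ++ O₁

/-- Weak equivalence by a chain that contains exactly `d` shift equivalences, all other links
of the chain being equivalences. -/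
inductive WeakEquivWith : ℕ → List (Fin m × Fin m) → List (Fin m × Fin m) → Prop
  | refl (O : List (Fin m × Fin m)) : WeakEquivWith 0 O O
  | equiv {d : ℕ} {O O₁ O' : List (Fin m × Fin m)} :
      OrdEquiv O O₁ → WeakEquivWith d O₁ O' → WeakEquivWith d O O'
  | shift {d : ℕ} {O O₁ O' : List (Fin m × Fin m)} :
      ShiftEquiv O O₁ → WeakEquivWith d O₁ O' → WeakEquivWith (d + 1) O O'

/-- The image of a pivot pair under a permutation of the block indices, written again as a pair
with first index smaller than the second one: the positions `(r, s)` and `(s, r)` are identified. -/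
def permPair (q : Equiv.Perm (Fin m)) (p : Fin m × Fin m) : Fin m × Fin m :=
  (min (q p.1) (q p.2), max (q p.1) (q p.2))

/-- Permutation equivalence of orderings. -/
def PermEquiv (O O' : List (Fin m × Fin m)) : Prop :=
  ∃ q : Equiv.Perm (Fin m), O' = O.map (permPair q)

/-- The column-wise orderings with permutations, `B_c`: the columns are taken from left to right,
and inside column `j` the positions `(i, j)`, `i < j`, are taken in an arbitrary order `τ j`. -/
def ColumnSerial (O : List (Fin m × Fin m)) : Prop :=
  ∃ τ : Fin m → List (Fin m),
    (∀ j, (τ j).Nodup ∧ ∀ i, i ∈ τ j ↔ i < j) ∧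
      O = (List.finRange m).flatMap fun j => (τ j).map fun i => (i, j)

/-- The row-wise orderings with permutations, `B_r`: the rows are taken from bottom to top,
and inside row `i` the positions `(i, j)`, `i < j`, are taken in an arbitrary order `τ i`. -/
def RowSerial (O : List (Fin m × Fin m)) : Prop :=
  ∃ τ : Fin m → List (Fin m),
    (∀ i, (τ i).Nodup ∧ ∀ j, j ∈ τ i ↔ i < j) ∧
      O = (List.finRange m).reverse.flatMap fun i => (τ i).map fun j => (i, j)

/-- The serial orderings with permutations, `B_sp`. -/
def SerialWithPermutations (O : List (Fin m × Fin m)) : Prop :=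
  ColumnSerial O ∨ ColumnSerial O.reverse ∨ RowSerial O ∨ RowSerial O.reverse

/-- `O` and `O''` are connected by a chain in the canonical form (one permutation equivalence and
one weak equivalence, in either order) that contains `d` shift equivalences. -/
def CanonicalChain (d : ℕ) (O O'' : List (Fin m × Fin m)) : Prop :=
  (∃ O', PermEquiv O O' ∧ WeakEquivWith d O' O'') ∨
    (∃ O', WeakEquivWith d O O' ∧ PermEquiv O' O'')

/-- `O` is a generalized serial pivot ordering, and a chain in the canonical form that connects it
with a serial ordering with permutations contains `d` shift equivalences. -/
def GeneralizedSerialWith (d : ℕ) (O : List (Fin m × Fin m)) : Prop :=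
  IsPivotOrdering O ∧
    ∃ O'', IsPivotOrdering O'' ∧ SerialWithPermutations O'' ∧ CanonicalChain d O O''

/-- `I` is the cyclic pivot strategy defined by the ordering `O`: it runs through `O`
periodically. -/
def IsCyclicStrategy (O : List (Fin m × Fin m)) (I : ℕ → Fin m × Fin m) : Prop :=
  ∀ k, O[k % O.length]? = some (I k)

end Orderings

noncomputable section

section OffNorm

open scoped Matrix.Norms.Frobenius

/-- The off-norm: the Frobenius norm of `A - diag(A)`. -/
def off {n : ℕ} (A : Matrix (Fin n) (Fin n) ℂ) : ℝ :=
  ‖A - Matrix.diagonal A.diag‖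

end OffNorm

/-- The smallest singular value of a square matrix of order `p ≥ 1`. Mathlib lists the singular
values in decreasing order, starting with index `0`. -/
def sigmaMin {p : ℕ} (V : Matrix (Fin p) (Fin p) ℂ) : ℝ :=
  (Matrix.toEuclideanLin V).singularValues (p - 1)

/-- The bound `γ_{ij}`, as a function of the sizes `n_i = p` and `n_j = q` of the two blocks. -/
def gammaBound (p q : ℕ) : ℝ :=
  max (3 / √(((q : ℝ) + 1) * ((4 : ℝ) ^ p + 6 * (q : ℝ) - 1)))
    (1 / √((p + q).choose p : ℝ))

section Blocks

/- A partition `π = (n_1, …, n_m)` of `n` is a `Composition n`: `m = π.length`,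
`n_r = π.blocksFun r`, `π.index a` is the block that contains `a`, and `π.embedding r` lists the
members of block `r`. -/
variable {n : ℕ} (π : Composition n)

/-- The block `A_{rs}`. -/
def block (A : Matrix (Fin n) (Fin n) ℂ) (r s : Fin π.length) :
    Matrix (Fin (π.blocksFun r)) (Fin (π.blocksFun s)) ℂ :=
  A.submatrix (π.embedding r) (π.embedding s)

/-- The pivot submatrix, composed of the blocks at `(i, i)`, `(i, j)`, `(j, i)`, `(j, j)`. -/
def pivotSubmatrix (A : Matrix (Fin n) (Fin n) ℂ) (i j : Fin π.length) :
    Matrix (Fin (π.blocksFun i) ⊕ Fin (π.blocksFun j))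
      (Fin (π.blocksFun i) ⊕ Fin (π.blocksFun j)) ℂ :=
  Matrix.fromBlocks (block π A i i) (block π A i j) (block π A j i) (block π A j j)

/-- A unitary elementary block matrix with pivot pair `(i, j)`: it differs from the identity at
most in the blocks at `(i, i)`, `(i, j)`, `(j, i)`, `(j, j)`. -/
structure IsUnitaryElementary (i j : Fin π.length) (V : Matrix (Fin n) (Fin n) ℂ) : Prop where
  unitary : V ∈ Matrix.unitaryGroup (Fin n) ℂ
  block_eq : ∀ r s : Fin π.length, ¬((r = i ∨ r = j) ∧ (s = i ∨ s = j)) →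
    block π V r s = block π 1 r s

/-- The class `UBCE_π(ϱ)`, for matrices with pivot pair `(i, j)`. -/
structure IsUBCE (ϱ : ℝ) (i j : Fin π.length) (V : Matrix (Fin n) (Fin n) ℂ) : Prop
    extends IsUnitaryElementary π i j V where
  sigmaMin_eq : sigmaMin (block π V i i) = sigmaMin (block π V j j)
  le_sigmaMin : ϱ * gammaBound (π.blocksFun i) (π.blocksFun j) ≤ sigmaMin (block π V i i)

/-- One step of the complex block Jacobi method with pivot pair `(i, j)`: `B = U^* A U`, where `U`
is a unitary elementary block matrix that diagonalizes the pivot submatrix of `A`. -/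
structure IsJacobiStep (i j : Fin π.length) (U A B : Matrix (Fin n) (Fin n) ℂ) : Prop where
  elementary : IsUnitaryElementary π i j U
  diagonalizes :
    ((pivotSubmatrix π U i j)ᴴ * pivotSubmatrix π A i j * pivotSubmatrix π U i j).IsDiag
  eq : B = Uᴴ * A * U

end Blocks

end

end BlockJacobi

/-!
The off-diagonal blocks of the iterates evolve by themselves (`IsJacobiStep.offBlock_eq`): a step
with pivot pair `p` is the linear map that conjugates by `U` and then annihilates the diagonal
blocks and the pivot submatrix (`annihilate`, `evolve`). This map does not depend on the diagonal
blocks, which may be arbitrarily large, and it does not increase the Frobenius norm. For fixed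
transformation matrices, the norm is preserved over a sequence of steps only if every pivot block is
zero when its turn comes, that is, if the sequence is a `LosslessRun`.

The combinatorial core is that a lossless run along sufficiently many sweeps of a generalized serial
ordering starts with the zero matrix (`Definite`). For a column-wise ordering, suppose that the
leading block submatrix before column `c` is already zero off its diagonal blocks. Until a row is
used as a pivot row, its block in column `c` is only multiplied by the diagonal blocks `U_cc`. These
are nonsingular, and the block is zero when its turn comes, so that it was zero from the beginning
(`LosslessRun.apply_eq_zero_of_column`). Lossless runs are reversible and can be renumbered, which
covers the other serial orderings and permutation equivalence. Admissible transpositions merely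
interchange commuting steps (`LosslessStep.swap`), and each shift is paid for by one more sweep, as
`[P, Q]` repeated `d + 2` times contains `[Q, P]` repeated `d + 1` times.

The bound `ϱ γ_ij ≤ σ_min` bounds the determinants of the diagonal blocks away from zero
(`pow_le_norm_det_of_le_sigmaMin`), so that the admissible matrices form a compact set. By
compactness, "less than the original norm at each point" improves to a uniform contraction
(`exists_contraction`). After the first sweep all the diagonal blocks are diagonal, so that `off` is
then the norm of the off-diagonal blocks. Finally, there are only finitely many orderings and
partitions, and for each ordering only the least possible number `d` of shifts matters.
-/

namespace BlockJacobi

/-! ### Pivot steps and lossless runs -/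

section Evolution

variable {N ι : Type*}

/-- The two block indices of a pivot pair. The order of the two entries is irrelevant. -/
abbrev pivotSet (p : ι × ι) : Set ι := {p.1, p.2}

/-- The diagonal block of index `r`. The blocks are given by a colouring `b` of the index set, which
makes renumbering the blocks a mere composition. -/
def diagBlock (b : N → ι) (U : Matrix N N ℂ) (r : ι) : Matrix {x // b x = r} {x // b x = r} ℂ :=
  U.submatrix (↑) (↑)

/-- The positions `(x, y)` that survive a step with pivot pair `p`: those outside the diagonal
blocks and outside the pivot submatrix. -/
def Kept (b : N → ι) (p : ι × ι) (x y : N) : Prop :=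
  b x ≠ b y ∧ ¬(b x ∈ pivotSet p ∧ b y ∈ pivotSet p)

/-- `a` vanishes in all the positions that a step with pivot pair `p` annihilates. -/
def Vanishes (b : N → ι) (p : ι × ι) (a : Matrix N N ℂ) : Prop :=
  ∀ x y, ¬Kept b p x y → a x y = 0

/-- `a` vanishes in the blocks whose row and column index both lie in `T`. -/
def ZeroOn (b : N → ι) (T : Set ι) (a : Matrix N N ℂ) : Prop :=
  ∀ x y, b x ∈ T → b y ∈ T → a x y = 0

lemma Vanishes.conjTranspose {b : N → ι} {p : ι × ι} {a : Matrix N N ℂ} (h : Vanishes b p a) :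
    Vanishes b p aᴴ := fun x y hxy => by
  rw [Matrix.conjTranspose_apply, h y x (fun hk => hxy ⟨hk.1.symm, fun h' => hk.2 h'.symm⟩),
    star_zero]

lemma Vanishes.zeroOn {b : N → ι} {p : ι × ι} {a : Matrix N N ℂ} (h : Vanishes b p a) :
    ZeroOn b (pivotSet p) a := fun x y hx hy => h x y fun hk => hk.2 ⟨hx, hy⟩

lemma vanishes_iff {b : N → ι} {p : ι × ι} {a : Matrix N N ℂ} :
    Vanishes b p a ↔ (∀ x y, b x = b y → a x y = 0) ∧ ZeroOn b (pivotSet p) a := by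
  refine ⟨fun h => ⟨fun x y hxy => h x y fun hk => hk.1 hxy, h.zeroOn⟩, fun h x y hk => ?_⟩
  by_cases hxy : b x = b y
  · exact h.1 x y hxy
  · by_contra hne
    exact hk ⟨hxy, fun h' => hne (h.2 x y h'.1 h'.2)⟩

variable [Fintype N] [DecidableEq N]

/-- A unitary matrix that differs from the identity at most inside the pivot submatrix of `p`. -/
structure IsElementary (b : N → ι) (p : ι × ι) (U : Matrix N N ℂ) : Prop where
  unitary : U ∈ Matrix.unitaryGroup N ℂ
  apply_eq : ∀ x y, ¬(b x ∈ pivotSet p ∧ b y ∈ pivotSet p) → U x y = (1 : Matrix N N ℂ) x y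

variable {b : N → ι} {p q : ι × ι} {U V a a' : Matrix N N ℂ}

lemma mul_conjTranspose_self_of_unitary (h : U ∈ Matrix.unitaryGroup N ℂ) : U * Uᴴ = 1 :=
  Matrix.mem_unitaryGroup_iff.1 h

lemma conj_conj_of_unitary (h : U ∈ Matrix.unitaryGroup N ℂ) (a : Matrix N N ℂ) :
    U * (Uᴴ * a * U) * Uᴴ = a := by
  have h1 := mul_conjTranspose_self_of_unitary h
  calc U * (Uᴴ * a * U) * Uᴴ = (U * Uᴴ) * a * (U * Uᴴ) := by simp only [Matrix.mul_assoc]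
    _ = a := by rw [h1, Matrix.one_mul, Matrix.mul_one]

lemma IsElementary.conjTranspose (h : IsElementary b p U) : IsElementary b p Uᴴ where
  unitary := Unitary.star_mem h.unitary
  apply_eq x y hxy := by
    rw [Matrix.conjTranspose_apply, h.apply_eq y x (fun h' => hxy h'.symm),
      ← Matrix.conjTranspose_apply, Matrix.conjTranspose_one]

lemma IsElementary.mul_apply_of_notMem (h : IsElementary b p U) (M : Matrix N N ℂ) (x : N) {y : N}
    (hy : b y ∉ pivotSet p) : (M * U) x y = M x y := by
  rw [Matrix.mul_apply, Finset.sum_congr rfl fun z _ => by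
    rw [h.apply_eq z y fun h' => hy h'.2], ← Matrix.mul_apply, Matrix.mul_one]

lemma IsElementary.conjTranspose_mul_apply_of_notMem (h : IsElementary b p U) (M : Matrix N N ℂ)
    {x : N} (y : N) (hx : b x ∉ pivotSet p) : (Uᴴ * M) x y = M x y := by
  rw [Matrix.mul_apply, Finset.sum_congr rfl fun z _ => by
    rw [h.conjTranspose.apply_eq x z fun h' => hx h'.1], ← Matrix.mul_apply, Matrix.one_mul]

/-- Conjugation by an elementary matrix changes no block outside the pivot rows and columns. -/
lemma IsElementary.conj_apply_of_notMem (h : IsElementary b p U) (a : Matrix N N ℂ) {x y : N}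
    (hx : b x ∉ pivotSet p) (hy : b y ∉ pivotSet p) : (Uᴴ * a * U) x y = a x y := by
  rw [h.mul_apply_of_notMem _ _ hy, h.conjTranspose_mul_apply_of_notMem _ _ hx]

/-- A principal block submatrix that contains the pivot submatrix is conjugated within itself, so
that it stays zero if it is zero. -/
lemma ZeroOn.conj {T : Set ι} (ha : ZeroOn b T a) (h : IsElementary b p U) (hT : pivotSet p ⊆ T) :
    ZeroOn b T (Uᴴ * a * U) := by
  have key : ∀ z y, b y ∈ T → b z ∉ T → U z y = 0 := fun z y hy hz => by
    rw [h.apply_eq z y fun h' => hz (hT h'.1), Matrix.one_apply_ne]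
    rintro rfl
    exact hz hy
  intro x y hx hy
  rw [Matrix.mul_apply]
  refine Finset.sum_eq_zero fun w _ => ?_
  by_cases hw : b w ∈ T
  · rw [Matrix.mul_apply, Finset.sum_eq_zero, zero_mul]
    intro z _
    by_cases hz : b z ∈ T
    · rw [ha z w hz hw, mul_zero]
    · rw [Matrix.conjTranspose_apply, key z x hx hz, star_zero, zero_mul]
  · rw [key w y hy hw, mul_zero]

lemma Vanishes.conj (ha : Vanishes b p a) (h : IsElementary b p U) :
    Vanishes b p (Uᴴ * a * U) := by
  obtain ⟨hd, hz⟩ := vanishes_iff.1 ha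
  have hz' := hz.conj h subset_rfl
  refine vanishes_iff.2 ⟨fun x y hxy => ?_, hz'⟩
  by_cases hx : b x ∈ pivotSet p
  · exact hz' x y hx (hxy ▸ hx)
  · rw [h.conj_apply_of_notMem a hx (hxy ▸ hx), hd x y hxy]

variable [DecidableEq ι]

/-- An elementary unitary matrix whose two pivot diagonal blocks are nonsingular. -/
structure IsRegular (b : N → ι) (p : ι × ι) (U : Matrix N N ℂ) : Prop
    extends IsElementary b p U where
  det_ne : ∀ r ∈ pivotSet p, (diagBlock b U r).det ≠ 0

lemma IsRegular.conjTranspose (h : IsRegular b p U) : IsRegular b p Uᴴ where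
  toIsElementary := h.toIsElementary.conjTranspose
  det_ne r hr := by
    have : diagBlock b Uᴴ r = (diagBlock b U r)ᴴ := rfl
    rw [this, Matrix.det_conjTranspose]
    exact star_ne_zero.2 (h.det_ne r hr)

/-- A step with pivot pair `p` in which nothing is annihilated. -/
def LosslessStep (b : N → ι) (p : ι × ι) (a a' : Matrix N N ℂ) : Prop :=
  Vanishes b p a ∧ ∃ U, IsRegular b p U ∧ a' = Uᴴ * a * U

/-- A sequence of lossless steps along a list of pivot pairs. -/
inductive LosslessRun (b : N → ι) : List (ι × ι) → Matrix N N ℂ → Matrix N N ℂ → Prop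
  | nil (a : Matrix N N ℂ) : LosslessRun b [] a a
  | cons {p : ι × ι} {O : List (ι × ι)} {a a₁ a' : Matrix N N ℂ} :
      LosslessStep b p a a₁ → LosslessRun b O a₁ a' → LosslessRun b (p :: O) a a'

lemma LosslessStep.symm (h : LosslessStep b p a a') : LosslessStep b p a' a := by
  obtain ⟨hv, U, hU, rfl⟩ := h
  refine ⟨hv.conj hU.toIsElementary, Uᴴ, hU.conjTranspose, ?_⟩
  rw [Matrix.conjTranspose_conjTranspose, conj_conj_of_unitary hU.unitary]

lemma LosslessStep.conjTranspose (h : LosslessStep b p a a') : LosslessStep b p aᴴ a'ᴴ := by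
  obtain ⟨hv, U, hU, rfl⟩ := h
  refine ⟨hv.conjTranspose, U, hU, ?_⟩
  simp [Matrix.conjTranspose_mul, Matrix.mul_assoc]

lemma LosslessStep.eq_zero_of_right (h : LosslessStep b p a 0) : a = 0 := by
  obtain ⟨-, U, -, h'⟩ := h.symm
  simpa using h'

lemma losslessRun_nil_iff : LosslessRun b [] a a' ↔ a' = a :=
  ⟨fun h => by cases h; rfl, fun h => h ▸ .nil _⟩

lemma losslessRun_cons_iff {O : List (ι × ι)} :
    LosslessRun b (p :: O) a a' ↔ ∃ a₁, LosslessStep b p a a₁ ∧ LosslessRun b O a₁ a' :=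
  ⟨fun h => by cases h with | cons h1 h2 => exact ⟨_, h1, h2⟩, fun ⟨_, h1, h2⟩ => .cons h1 h2⟩

lemma losslessRun_append_iff {O O' : List (ι × ι)} :
    LosslessRun b (O ++ O') a a' ↔ ∃ a₁, LosslessRun b O a a₁ ∧ LosslessRun b O' a₁ a' := by
  induction O generalizing a with
  | nil => simp [losslessRun_nil_iff]
  | cons p O ih =>
    simp only [List.cons_append, losslessRun_cons_iff, ih]
    exact ⟨fun ⟨a₁, h1, a₂, h2, h3⟩ => ⟨a₂, ⟨a₁, h1, h2⟩, h3⟩,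
      fun ⟨a₂, ⟨a₁, h1, h2⟩, h3⟩ => ⟨a₁, h1, a₂, h2, h3⟩⟩

lemma losslessRun_singleton_iff : LosslessRun b [p] a a' ↔ LosslessStep b p a a' := by
  simp [losslessRun_cons_iff, losslessRun_nil_iff]

/-- A lossless run can be traversed backwards. -/
lemma LosslessRun.reverse {O : List (ι × ι)} (h : LosslessRun b O a a') :
    LosslessRun b O.reverse a' a := by
  induction h with
  | nil => exact .nil _
  | cons h1 _ ih =>
    rw [List.reverse_cons]
    exact losslessRun_append_iff.2 ⟨_, ih, losslessRun_singleton_iff.2 h1.symm⟩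

lemma LosslessRun.conjTranspose {O : List (ι × ι)} (h : LosslessRun b O a a') :
    LosslessRun b O aᴴ a'ᴴ := by
  induction h with
  | nil => exact .nil _
  | cons h1 _ ih => exact .cons h1.conjTranspose ih

lemma LosslessRun.eq_zero_of_right {O : List (ι × ι)} (h : LosslessRun b O a a') (h0 : a' = 0) :
    a = 0 := by
  induction h with
  | nil => exact h0
  | cons h1 _ ih => exact LosslessStep.eq_zero_of_right (ih h0 ▸ h1)

lemma LosslessRun.diag_eq_zero {O : List (ι × ι)} (h : LosslessRun b O a a')
    (hd : ∀ x y, b x = b y → a x y = 0) : ∀ x y, b x = b y → a' x y = 0 := by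
  induction h with
  | nil => exact hd
  | cons h1 _ ih => exact ih fun x y => (vanishes_iff.1 h1.symm.1).1 x y

lemma LosslessRun.zeroOn {O : List (ι × ι)} (h : LosslessRun b O a a') {T : Set ι}
    (hT : ∀ p ∈ O, pivotSet p ⊆ T) (ha : ZeroOn b T a) : ZeroOn b T a' := by
  induction h with
  | nil => exact ha
  | @cons p O a a₁ a' h1 _ ih =>
    obtain ⟨-, U, hU, rfl⟩ := h1
    exact ih (fun p hp => hT p (List.mem_cons_of_mem _ hp))
      (ha.conj hU.toIsElementary (hT _ List.mem_cons_self))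

/-- Relabelling the blocks transports lossless runs. -/
lemma LosslessRun.map {κ : Type*} [DecidableEq κ] {O : List (ι × ι)}
    (h : LosslessRun b O a a') (e : ι ≃ κ) (f : ι × ι → κ × κ)
    (hf : ∀ p, pivotSet (f p) = e '' pivotSet p) :
    LosslessRun (e ∘ b) (O.map f) a a' := by
  have hmem : ∀ p x, (e ∘ b) x ∈ pivotSet (f p) ↔ b x ∈ pivotSet p := fun p x => by
    rw [hf, Function.comp_apply, e.injective.mem_set_image]
  have hk : ∀ p x y, Kept (e ∘ b) (f p) x y ↔ Kept b p x y := fun p x y => by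
    unfold Kept
    rw [hmem, hmem, Function.comp_apply, Function.comp_apply, e.injective.ne_iff]
  induction h with
  | nil => exact .nil _
  | @cons p O a a₁ a' h1 _ ih =>
    refine .cons ?_ ih
    obtain ⟨hv, U, hU, rfl⟩ := h1
    refine ⟨fun x y hxy => hv x y (by rwa [← hk]), U, ⟨⟨hU.unitary, fun x y hxy => ?_⟩, ?_⟩, rfl⟩
    · exact hU.apply_eq x y (by rwa [hmem, hmem] at hxy)
    · rw [hf]
      rintro _ ⟨r, hr, rfl⟩
      have hdet := hU.det_ne r hr
      rw [← Matrix.det_submatrix_equiv_self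
        (Equiv.subtypeEquivRight fun x => e.injective.eq_iff (a := b x) (b := r))] at hdet
      exact hdet

/-- Two consecutive lossless steps with disjoint pivot sets can be interchanged. -/
lemma LosslessStep.swap {a₁ a₂ : Matrix N N ℂ} (hpq : Disjoint (pivotSet p) (pivotSet q))
    (h1 : LosslessStep b p a a₁) (h2 : LosslessStep b q a₁ a₂) :
    ∃ a₁', LosslessStep b q a a₁' ∧ LosslessStep b p a₁' a₂ := by
  obtain ⟨hv, U, hU, rfl⟩ := h1
  obtain ⟨hv', V, hV, rfl⟩ := h2
  have hnp : ∀ {r}, r ∈ pivotSet q → r ∉ pivotSet p := fun hq hp => Set.disjoint_left.1 hpq hp hq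
  have hnq : ∀ {r}, r ∈ pivotSet p → r ∉ pivotSet q := fun hp hq => Set.disjoint_left.1 hpq hp hq
  obtain ⟨hd, hz⟩ := vanishes_iff.1 hv
  have haq : Vanishes b q a := by
    refine vanishes_iff.2 ⟨hd, fun x y hx hy => ?_⟩
    rw [← hU.conj_apply_of_notMem a (hnp hx) (hnp hy)]
    exact hv'.zeroOn x y hx hy
  have hVa := vanishes_iff.1 (haq.conj hV.toIsElementary)
  refine ⟨_, ⟨haq, V, hV, rfl⟩, vanishes_iff.2 ⟨hVa.1, fun x y hx hy => ?_⟩, U, hU, ?_⟩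
  · rw [hV.conj_apply_of_notMem a (hnq hx) (hnq hy)]
    exact hz x y hx hy
  · have hcomm : U * V = V * U := by
      -- `(U - 1) * (V - 1)` and `(V - 1) * (U - 1)` vanish, the supports being disjoint.
      have h0 : ∀ {p q : ι × ι} {U V : Matrix N N ℂ}, IsElementary b p U → IsElementary b q V →
          Disjoint (pivotSet p) (pivotSet q) → (U - 1) * (V - 1) = 0 := by
        intro p q U V hU hV hpq
        ext x y
        rw [Matrix.mul_apply]
        refine Finset.sum_eq_zero fun z _ => ?_
        by_cases hz : b z ∈ pivotSet p
        · rw [Matrix.sub_apply V, hV.apply_eq z y fun h' => Set.disjoint_left.1 hpq hz h'.1,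
            sub_self, mul_zero]
        · rw [Matrix.sub_apply U, hU.apply_eq x z fun h' => hz h'.2, sub_self, zero_mul]
      have e1 := h0 hU.toIsElementary hV.toIsElementary hpq
      have e2 := h0 hV.toIsElementary hU.toIsElementary hpq.symm
      have : U * V - V * U = (U - 1) * (V - 1) - (V - 1) * (U - 1) := by noncomm_ring
      rw [e1, e2, sub_self] at this
      exact sub_eq_zero.1 this
    calc Vᴴ * (Uᴴ * a * U) * V = (U * V)ᴴ * a * (U * V) := by
          simp only [Matrix.conjTranspose_mul, Matrix.mul_assoc]
      _ = (V * U)ᴴ * a * (V * U) := by rw [hcomm]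
      _ = Uᴴ * (Vᴴ * a * V) * U := by simp only [Matrix.conjTranspose_mul, Matrix.mul_assoc]

end Evolution

/-! ### Serial orderings leave no nonzero lossless run -/

section Serial

variable {N ι : Type*} [Fintype N] [DecidableEq N] [DecidableEq ι] {b : N → ι} {a a' : Matrix N N ℂ}

/-- Pivoting through column `c` while the blocks of the rows in question are zero among
themselves: until a row `r` is used as a pivot row, its block in column `c` is only multiplied by
nonsingular diagonal blocks, and it is zero when its turn comes. -/
lemma LosslessRun.apply_eq_zero_of_column {c : ι} {τ : List ι} (hτ : τ.Nodup) (hc : c ∉ τ)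
    (h : LosslessRun b (τ.map fun i => (i, c)) a a') (ha : ZeroOn b {i | i ∈ τ} a)
    (x y : N) (hx : b x ∈ τ) (hy : b y = c) : a x y = 0 := by
  induction τ generalizing a x y with
  | nil => simp at hx
  | cons t τ ih =>
    obtain ⟨a₁, h1, h2⟩ := losslessRun_cons_iff.1 h
    obtain ⟨hv, U, hU, rfl⟩ := h1
    rw [List.nodup_cons] at hτ
    have hct : t ≠ c := fun e => hc (e ▸ List.mem_cons_self)
    have hcτ : c ∉ τ := fun e => hc (List.mem_cons_of_mem _ e)
    by_cases hxt : b x = t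
    · exact hv.zeroOn x y (by simp [hxt]) (by simp [hy])
    have hxτ : b x ∈ τ := (List.mem_cons.1 hx).resolve_left hxt
    have hout : ∀ r ∈ τ, r ∉ pivotSet (t, c) := by
      rintro r hr (rfl | rfl)
      · exact hτ.1 hr
      · exact hcτ hr
    have hz : ∀ z, b z = c → (Uᴴ * a * U) x z = 0 := fun z hz' => by
      refine ih hτ.2 hcτ h2 (fun u w hu hw => ?_) x z hxτ hz'
      rw [hU.conj_apply_of_notMem a (hout _ hu) (hout _ hw)]
      exact ha u w (List.mem_cons_of_mem _ hu) (List.mem_cons_of_mem _ hw)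
    have hvec : (fun w : {w // b w = c} => a x w) ᵥ* diagBlock b U c = 0 := by
      ext ⟨z, hzc⟩
      rw [Pi.zero_apply, ← hz z hzc, Matrix.mul_assoc,
        hU.conjTranspose_mul_apply_of_notMem _ _ (hout _ hxτ), Matrix.mul_apply]
      symm
      have hs : ∀ w, a x w * U w z ≠ 0 → b w = c := fun w hw => by
        by_contra hwc
        by_cases hwt : b w = t
        · exact hw (by rw [ha x w (List.mem_cons_of_mem _ hxτ) (by simp [hwt]), zero_mul])
        · refine hw ?_
          rw [hU.apply_eq w z (fun h' => h'.1.elim hwt hwc), Matrix.one_apply_ne, mul_zero]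
          rintro rfl
          exact hwc hzc
      rw [← Finset.sum_filter_of_ne (fun w _ => hs w), Finset.sum_subtype (p := fun w => b w = c)]
      · rfl
      · simp
    exact congrFun (Matrix.eq_zero_of_vecMul_eq_zero (hU.det_ne c (by simp)) hvec) ⟨y, hy⟩

/-- If the columns `cs` are taken one after another, and column `c` is combined with the indices
that precede `c` in `cs`, then a lossless run ends in zero on all the indices of `cs`. -/
lemma LosslessRun.zeroOn_of_serial {τ : ι → List ι} {cs : List ι}
    (hτ : ∀ l c l', cs = l ++ c :: l' → (τ c).Nodup ∧ c ∉ l ∧ ∀ i, i ∈ τ c ↔ i ∈ l)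
    (hd : ∀ x y, b x = b y → a x y = 0)
    (h : LosslessRun b (cs.flatMap fun c => (τ c).map fun i => (i, c)) a a') :
    ZeroOn b {i | i ∈ cs} a' := by
  induction cs using List.reverseRecOn generalizing a' with
  | nil => intro x y hx; simp at hx
  | append_singleton l c ih =>
    rw [List.flatMap_append, losslessRun_append_iff] at h
    obtain ⟨a₁, h1, h2⟩ := h
    rw [List.flatMap_singleton] at h2
    have hz := ih (fun l₁ c₁ l₂ e => hτ l₁ c₁ (l₂ ++ [c]) (by simp [e])) h1
    obtain ⟨hn, hcl, hm⟩ := hτ l c [] rfl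
    have hz' : ZeroOn b {i | i ∈ τ c} a₁ :=
      fun x y hx hy => hz x y ((hm _).1 hx) ((hm _).1 hy)
    have hc : c ∉ τ c := fun h => hcl ((hm _).1 h)
    have hz'' : ZeroOn b {i | i ∈ τ c} a₁ᴴ := fun x y hx hy => by
      rw [Matrix.conjTranspose_apply, hz' y x hy hx, star_zero]
    refine h2.zeroOn ?_ ?_
    · simp only [List.mem_map, forall_exists_index, and_imp]
      rintro _ i hi rfl r (rfl | rfl)
      · simp [(hm _).1 hi]
      · simp
    · intro x y hx hy
      replace hx := List.mem_append.1 hx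
      replace hy := List.mem_append.1 hy
      rw [List.mem_singleton] at hx hy
      rcases hx with hx | hx <;> rcases hy with hy | hy
      · exact hz x y hx hy
      · exact h2.apply_eq_zero_of_column hn hc hz' x y ((hm _).2 hx) hy
      · have := h2.conjTranspose.apply_eq_zero_of_column hn hc hz'' y x ((hm _).2 hy) hx
        rwa [Matrix.conjTranspose_apply, star_eq_zero] at this
      · exact h1.diag_eq_zero hd x y (hx.trans hy.symm)

/-- `O` is definite if, for every partition into blocks, a lossless run along `O` that starts with
zero diagonal blocks starts with the zero matrix. The partition is part of the quantification, so
that the notion is invariant under renumbering the blocks. -/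
def Definite (N : Type*) [Fintype N] [DecidableEq N] (O : List (ι × ι)) : Prop :=
  ∀ (b : N → ι) (a a' : Matrix N N ℂ), (∀ x y, b x = b y → a x y = 0) →
    LosslessRun b O a a' → a = 0

lemma definite_of_serial {τ : ι → List ι} {cs : List ι} (hcs : ∀ i, i ∈ cs)
    (hτ : ∀ l c l', cs = l ++ c :: l' → (τ c).Nodup ∧ c ∉ l ∧ ∀ i, i ∈ τ c ↔ i ∈ l) :
    Definite N (cs.flatMap fun c => (τ c).map fun i => (i, c)) := by
  intro b a a' hd h
  have hz := h.zeroOn_of_serial hτ hd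
  have : a' = 0 := by
    ext x y
    exact hz x y (hcs _) (hcs _)
  exact h.eq_zero_of_right this

lemma Definite.reverse {O : List (ι × ι)} (h : Definite N O) : Definite N O.reverse := by
  intro b a a' hd hr
  have hr' := hr.reverse
  rw [List.reverse_reverse] at hr'
  exact hr.eq_zero_of_right (h b a' a (hr.diag_eq_zero hd) hr')

/-- Definiteness is invariant under renumbering the blocks and reordering the entries of pairs. -/
lemma Definite.of_map {κ : Type*} [DecidableEq κ] {O : List (ι × ι)} (e : ι ≃ κ) (f : ι × ι → κ × κ)
    (hf : ∀ p, pivotSet (f p) = e '' pivotSet p) (h : Definite N (O.map f)) : Definite N O :=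
  fun b a a' hd hr => h (e ∘ b) a a' (fun x y hxy => hd x y (e.injective hxy)) (hr.map e f hf)

lemma Definite.map_swap {O : List (ι × ι)} (h : Definite N O) :
    Definite N (O.map Prod.swap) := by
  refine Definite.of_map (Equiv.refl ι) Prod.swap (fun p => ?_) (by simpa using h)
  simp [pivotSet, Set.pair_comm]

lemma mem_prefix_iff_of_pairwise {α : Type*} {r : α → α → Prop} [Std.Irrefl r] [Std.Asymm r]
    {l l' : List α} {c : α} (h : (l ++ c :: l').Pairwise r) (hmem : ∀ i, i ∈ l ++ c :: l') :
    c ∉ l ∧ ∀ i, i ∈ l ↔ r i c := by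
  rw [List.pairwise_append, List.pairwise_cons] at h
  have h1 : ∀ i ∈ l, r i c := fun i hi => h.2.2 i hi c List.mem_cons_self
  refine ⟨fun hc => Std.Irrefl.irrefl (r := r) c (h1 c hc), fun i => ⟨h1 i, fun hr => ?_⟩⟩
  have := hmem i
  rw [List.mem_append, List.mem_cons] at this
  rcases this with h' | rfl | h'
  · exact h'
  · exact absurd hr (Std.Irrefl.irrefl (r := r) i)
  · exact absurd hr (Std.Asymm.asymm (r := r) _ _ (h.2.1.1 i h'))

variable {m : ℕ}

lemma ColumnSerial.definite {O : List (Fin m × Fin m)} (h : ColumnSerial O) : Definite N O := by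
  obtain ⟨τ, hτ, rfl⟩ := h
  refine definite_of_serial List.mem_finRange fun l c l' e => ?_
  have := mem_prefix_iff_of_pairwise (e ▸ List.pairwise_lt_finRange m)
    (e ▸ List.mem_finRange)
  exact ⟨(hτ c).1, this.1, fun i => ((hτ c).2 i).trans (this.2 i).symm⟩

lemma RowSerial.definite {O : List (Fin m × Fin m)} (h : RowSerial O) : Definite N O := by
  obtain ⟨τ, hτ, rfl⟩ := h
  have hp : (List.finRange m).reverse.Pairwise (· > ·) :=
    List.pairwise_reverse.2 (List.pairwise_lt_finRange m)
  have hm : ∀ i, i ∈ (List.finRange m).reverse := by simp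
  have := (definite_of_serial (N := N) (τ := τ) hm fun l c l' e => by
    have := mem_prefix_iff_of_pairwise (e ▸ hp) (e ▸ hm)
    exact ⟨(hτ c).1, this.1, fun i => ((hτ c).2 i).trans (this.2 i).symm⟩).map_swap
  simpa [List.map_flatMap, Function.comp_def] using this

lemma SerialWithPermutations.definite {O : List (Fin m × Fin m)} (h : SerialWithPermutations O) :
    Definite N O := by
  rcases h with h | h | h | h
  · exact h.definite
  · simpa using h.definite.reverse (N := N)
  · exact h.definite
  · simpa using h.definite.reverse (N := N)

end Serial

/-! ### Weak equivalence and permutation equivalence -/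

section Equivalence

variable {N : Type*} [Fintype N] [DecidableEq N] {m : ℕ}

lemma LosslessRun.of_admissibleTransposition {b : N → Fin m} {a a' : Matrix N N ℂ}
    {O O' : List (Fin m × Fin m)} (hO : AdmissibleTransposition O O') (h : LosslessRun b O a a') :
    LosslessRun b O' a a' := by
  obtain ⟨L, R, p, q, hpq, rfl, rfl⟩ := hO
  simp only [losslessRun_append_iff, losslessRun_cons_iff] at h ⊢
  obtain ⟨a₁, h1, a₂, h2, a₃, h3, h4⟩ := h
  obtain ⟨a₂', h2', h3'⟩ := h2.swap hpq h3
  exact ⟨a₁, h1, a₂', h2', a₃, h3', h4⟩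

lemma LosslessRun.of_ordEquiv {b : N → Fin m} {a a' : Matrix N N ℂ}
    {O O' : List (Fin m × Fin m)} (hO : OrdEquiv O O') (h : LosslessRun b O a a') :
    LosslessRun b O' a a' := by
  induction hO with
  | refl => exact h
  | tail _ h2 ih => exact ih.of_admissibleTransposition h2

/-- `k` repetitions of the ordering `O`. -/
def sweeps {α : Type*} (k : ℕ) (O : List α) : List α := (List.replicate k O).flatten

lemma sweeps_zero {α : Type*} (O : List α) : sweeps 0 O = [] := rfl

lemma sweeps_succ {α : Type*} (k : ℕ) (O : List α) : sweeps (k + 1) O = O ++ sweeps k O := by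
  simp [sweeps, List.replicate_succ]

lemma sweeps_one {α : Type*} (O : List α) : sweeps 1 O = O := by simp [sweeps]

lemma sweeps_shift {α : Type*} (k : ℕ) (P Q : List α) :
    sweeps (k + 1) (P ++ Q) = P ++ sweeps k (Q ++ P) ++ Q := by
  induction k with
  | zero => simp [sweeps_one, sweeps_zero]
  | succ k ih => rw [sweeps_succ, ih, sweeps_succ]; simp

lemma LosslessRun.sweeps_of_ordEquiv {b : N → Fin m} {a a' : Matrix N N ℂ}
    {O O' : List (Fin m × Fin m)} (hO : OrdEquiv O O') (k : ℕ)
    (h : LosslessRun b (sweeps k O) a a') : LosslessRun b (sweeps k O') a a' := by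
  induction k generalizing a with
  | zero => exact h
  | succ k ih =>
    rw [sweeps_succ, losslessRun_append_iff] at h ⊢
    obtain ⟨a₁, h1, h2⟩ := h
    exact ⟨a₁, h1.of_ordEquiv hO, ih h2⟩

/-- Each shift equivalence costs one sweep: `[P, Q]` repeated `k + 1` times contains `[Q, P]`
repeated `k` times. -/
lemma WeakEquivWith.definite_sweeps {d : ℕ} {O O' : List (Fin m × Fin m)}
    (h : WeakEquivWith d O O') (h' : Definite N O') : Definite N (sweeps (d + 1) O) := by
  induction h with
  | refl => rwa [sweeps_one]
  | equiv h1 _ ih => exact fun b a a' hd hr => ih h' b a a' hd (hr.sweeps_of_ordEquiv h1)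
  | shift h1 _ ih =>
    obtain ⟨P, Q, rfl, rfl⟩ := h1
    intro b a a' hd hr
    rw [sweeps_shift, List.append_assoc, losslessRun_append_iff] at hr
    obtain ⟨a₁, hr1, hr2⟩ := hr
    obtain ⟨a₂, hr2, -⟩ := losslessRun_append_iff.1 hr2
    exact hr1.eq_zero_of_right (ih h' b a₁ a₂ (hr1.diag_eq_zero hd) hr2)

lemma PermEquiv.definite_sweeps {O O' : List (Fin m × Fin m)} (h : PermEquiv O O') (k : ℕ)
    (h' : Definite N (sweeps k O')) : Definite N (sweeps k O) := by
  obtain ⟨q, rfl⟩ := h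
  refine Definite.of_map q (permPair q) (fun p => ?_) ?_
  · rw [pivotSet, pivotSet, Set.image_pair, permPair]
    rcases le_total (q p.1) (q p.2) with h | h
    · simp [h]
    · simp [h, Set.pair_comm]
  · simpa [sweeps, List.map_flatten] using h'

lemma GeneralizedSerialWith.definite_sweeps {d : ℕ} {O : List (Fin m × Fin m)}
    (h : GeneralizedSerialWith d O) : Definite N (sweeps (d + 1) O) := by
  obtain ⟨-, O'', -, hs, ⟨O', hp, hw⟩ | ⟨O', hw, hp⟩⟩ := h
  · exact hp.definite_sweeps _ (hw.definite_sweeps hs.definite)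
  · have := hp.definite_sweeps (N := N) 1 (by rw [sweeps_one]; exact hs.definite)
    rw [sweeps_one] at this
    exact hw.definite_sweeps this

end Equivalence

/-! ### The annihilators and their compactness -/

section Contraction

variable {N ι : Type*}

open Classical in
/-- The matrix `M` with the diagonal blocks and the pivot submatrix of `p` replaced by zero. -/
noncomputable def annihilate (b : N → ι) (p : ι × ι) (M : Matrix N N ℂ) : Matrix N N ℂ :=
  Matrix.of fun x y => if Kept b p x y then M x y else 0

lemma annihilate_apply_of_kept {b : N → ι} {p : ι × ι} {x y : N} (h : Kept b p x y)
    (M : Matrix N N ℂ) : annihilate b p M x y = M x y := if_pos h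

lemma annihilate_apply_of_not_kept {b : N → ι} {p : ι × ι} {x y : N} (h : ¬Kept b p x y)
    (M : Matrix N N ℂ) : annihilate b p M x y = 0 := if_neg h

lemma norm_annihilate_apply_le (b : N → ι) (p : ι × ι) (M : Matrix N N ℂ) (x y : N) :
    ‖annihilate b p M x y‖ ≤ ‖M x y‖ := by
  by_cases h : Kept b p x y
  · rw [annihilate_apply_of_kept h]
  · rw [annihilate_apply_of_not_kept h, norm_zero]
    exact norm_nonneg _

lemma Vanishes.annihilate_eq {b : N → ι} {p : ι × ι} {M : Matrix N N ℂ} (h : Vanishes b p M) :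
    annihilate b p M = M := by
  ext x y
  by_cases hk : Kept b p x y
  · rw [annihilate_apply_of_kept hk]
  · rw [annihilate_apply_of_not_kept hk, h x y hk]

lemma annihilate_smul (b : N → ι) (p : ι × ι) (c : ℂ) (M : Matrix N N ℂ) :
    annihilate b p (c • M) = c • annihilate b p M := by
  ext x y
  by_cases hk : Kept b p x y
  · simp [annihilate_apply_of_kept hk]
  · simp [annihilate_apply_of_not_kept hk]

lemma continuous_annihilate (b : N → ι) (p : ι × ι) : Continuous (annihilate b p) := by
  refine continuous_matrix fun x y => ?_
  by_cases hk : Kept b p x y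
  · simp only [annihilate_apply_of_kept hk]
    exact continuous_id.matrix_elem x y
  · simp only [annihilate_apply_of_not_kept hk]
    exact continuous_const

lemma isCompact_of_isClosed_of_norm_le {s : Set (Matrix N N ℂ)} (hs : IsClosed s)
    (hb : ∀ a ∈ s, ∀ x y, ‖a x y‖ ≤ 1) : IsCompact s := by
  have hc : IsCompact (Set.pi Set.univ fun _ : N => Set.pi Set.univ fun _ : N =>
      Metric.closedBall (0 : ℂ) 1) :=
    isCompact_univ_pi fun _ => isCompact_univ_pi fun _ => isCompact_closedBall 0 1
  exact hc.of_isClosed_subset hs fun a ha x _ y _ => by simpa using hb a ha x y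

variable [Fintype N]

/-- The squared Frobenius norm. -/
noncomputable def frobSq (a : Matrix N N ℂ) : ℝ := ∑ x, ∑ y, ‖a x y‖ ^ 2

lemma frobSq_nonneg (a : Matrix N N ℂ) : 0 ≤ frobSq a :=
  Finset.sum_nonneg fun _ _ => Finset.sum_nonneg fun _ _ => sq_nonneg _

lemma frobSq_zero : frobSq (0 : Matrix N N ℂ) = 0 := by simp [frobSq]

lemma frobSq_smul (c : ℂ) (a : Matrix N N ℂ) : frobSq (c • a) = ‖c‖ ^ 2 * frobSq a := by
  simp [frobSq, Finset.mul_sum, mul_pow]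

lemma norm_sq_apply_le_frobSq (a : Matrix N N ℂ) (x y : N) : ‖a x y‖ ^ 2 ≤ frobSq a :=
  (Finset.single_le_sum (f := fun y => ‖a x y‖ ^ 2) (fun _ _ => sq_nonneg _)
    (Finset.mem_univ y)).trans
    (Finset.single_le_sum (f := fun x => ∑ y, ‖a x y‖ ^ 2)
      (fun _ _ => Finset.sum_nonneg fun _ _ => sq_nonneg _) (Finset.mem_univ x))

lemma frobSq_mono {a a' : Matrix N N ℂ} (h : ∀ x y, ‖a x y‖ ≤ ‖a' x y‖) :
    frobSq a ≤ frobSq a' :=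
  Finset.sum_le_sum fun x _ => Finset.sum_le_sum fun y _ =>
    pow_le_pow_left₀ (norm_nonneg _) (h x y) 2

lemma frobSq_eq_trace (a : Matrix N N ℂ) : (frobSq a : ℂ) = (aᴴ * a).trace := by
  simp only [frobSq, Matrix.trace, Matrix.diag_apply, Matrix.mul_apply,
    Matrix.conjTranspose_apply]
  rw [Finset.sum_comm]
  push_cast
  refine Finset.sum_congr rfl fun x _ => Finset.sum_congr rfl fun y _ => ?_
  rw [Complex.star_def, Complex.conj_mul']

lemma frobSq_conj [DecidableEq N] {U : Matrix N N ℂ} (hU : U ∈ Matrix.unitaryGroup N ℂ)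
    (a : Matrix N N ℂ) : frobSq (Uᴴ * a * U) = frobSq a := by
  have h := mul_conjTranspose_self_of_unitary hU
  apply Complex.ofReal_injective
  rw [frobSq_eq_trace, frobSq_eq_trace]
  calc ((Uᴴ * a * U)ᴴ * (Uᴴ * a * U)).trace
      = (Uᴴ * (aᴴ * ((U * Uᴴ) * (a * U)))).trace := by
        simp only [Matrix.conjTranspose_mul, Matrix.conjTranspose_conjTranspose, Matrix.mul_assoc]
    _ = (aᴴ * (a * U) * Uᴴ).trace := by rw [h, Matrix.one_mul, Matrix.trace_mul_comm]
    _ = (aᴴ * a).trace := by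
        rw [Matrix.mul_assoc, Matrix.mul_assoc a, h, Matrix.mul_one]

lemma continuous_frobSq : Continuous (frobSq : Matrix N N ℂ → ℝ) := by
  unfold frobSq
  refine continuous_finsetSum _ fun x _ => continuous_finsetSum _ fun y _ => ?_
  exact (continuous_id.matrix_elem x y).norm.pow 2

lemma frobSq_annihilate_le (b : N → ι) (p : ι × ι) (M : Matrix N N ℂ) :
    frobSq (annihilate b p M) ≤ frobSq M := frobSq_mono (norm_annihilate_apply_le b p M)

lemma vanishes_of_frobSq_annihilate_eq {b : N → ι} {p : ι × ι} {M : Matrix N N ℂ}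
    (h : frobSq (annihilate b p M) = frobSq M) : Vanishes b p M := by
  intro x y hk
  have hle : ∀ x y, ‖annihilate b p M x y‖ ^ 2 ≤ ‖M x y‖ ^ 2 := fun x y =>
    pow_le_pow_left₀ (norm_nonneg _) (norm_annihilate_apply_le b p M x y) 2
  have h1 := (Finset.sum_eq_sum_iff_of_le fun x _ =>
    Finset.sum_le_sum fun y (_ : y ∈ Finset.univ) => hle x y).1 h x (Finset.mem_univ x)
  have h2 := (Finset.sum_eq_sum_iff_of_le fun y _ => hle x y).1 h1 y (Finset.mem_univ y)
  rw [annihilate_apply_of_not_kept hk] at h2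
  simpa using h2.symm

/-- The evolution of the off-diagonal blocks: each step is the linear map that conjugates by the
transformation matrix and annihilates the diagonal blocks and the pivot submatrix. -/
noncomputable def evolve (b : N → ι) (I : ℕ → ι × ι) (U : ℕ → Matrix N N ℂ) (a : Matrix N N ℂ) :
    ℕ → Matrix N N ℂ
  | 0 => a
  | k + 1 => annihilate b (I k) ((U k)ᴴ * evolve b I U a k * U k)

variable {b : N → ι} {I : ℕ → ι × ι}

lemma evolve_smul (U : ℕ → Matrix N N ℂ) (c : ℂ) (a : Matrix N N ℂ) (k : ℕ) :
    evolve b I U (c • a) k = c • evolve b I U a k := by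
  induction k with
  | zero => rfl
  | succ k ih => rw [evolve, evolve, ih, Matrix.mul_smul, Matrix.smul_mul, annihilate_smul]

lemma evolve_congr {U V : ℕ → Matrix N N ℂ} {k : ℕ} (h : ∀ l < k, U l = V l)
    (a : Matrix N N ℂ) : evolve b I U a k = evolve b I V a k := by
  induction k with
  | zero => rfl
  | succ k ih => rw [evolve, evolve, ih fun l hl => h l (hl.trans k.lt_succ_self),
      h k k.lt_succ_self]

lemma continuous_evolve (b : N → ι) (I : ℕ → ι × ι) (k : ℕ) :
    Continuous fun z : (ℕ → Matrix N N ℂ) × Matrix N N ℂ => evolve b I z.1 z.2 k := by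
  induction k with
  | zero => exact continuous_snd
  | succ k ih =>
    have hU : Continuous fun z : (ℕ → Matrix N N ℂ) × Matrix N N ℂ => z.1 k :=
      (continuous_apply k).comp continuous_fst
    exact (continuous_annihilate b (I k)).comp
      ((hU.matrix_conjTranspose.matrix_mul ih).matrix_mul hU)

variable [DecidableEq N]

lemma frobSq_evolve_antitone {U : ℕ → Matrix N N ℂ} {K : ℕ}
    (hU : ∀ k < K, U k ∈ Matrix.unitaryGroup N ℂ) (a : Matrix N N ℂ) {k l : ℕ} (hkl : k ≤ l)
    (hl : l ≤ K) : frobSq (evolve b I U a l) ≤ frobSq (evolve b I U a k) := by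
  induction l, hkl using Nat.le_induction with
  | base => exact le_rfl
  | succ l _ ih =>
    refine le_trans ?_ (ih (l.le_succ.trans hl))
    rw [evolve, ← frobSq_conj (hU l hl) (evolve b I U a l)]
    exact frobSq_annihilate_le _ _ _

variable [DecidableEq ι]

/-- If the evolution loses nothing of the Frobenius norm, it is a lossless run. -/
lemma losslessRun_of_frobSq_evolve_eq {U : ℕ → Matrix N N ℂ} {K : ℕ}
    (hU : ∀ k < K, IsRegular b (I k) (U k)) {a : Matrix N N ℂ}
    (h : frobSq (evolve b I U a K) = frobSq a) :
    LosslessRun b ((List.range K).map I) a (evolve b I U a K) := by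
  induction K with
  | zero => exact .nil _
  | succ K ih =>
    have hu : ∀ k < K + 1, U k ∈ Matrix.unitaryGroup N ℂ := fun k hk => (hU k hk).unitary
    have h1 := frobSq_evolve_antitone (b := b) (I := I) hu a K.le_succ le_rfl
    have h2 := frobSq_evolve_antitone (b := b) (I := I) hu a K.zero_le K.le_succ
    change _ ≤ frobSq a at h2
    -- The norms between the first and the last one are squeezed to the same value.
    have h3 : frobSq (evolve b I U a K) = frobSq a := le_antisymm h2 (h ▸ h1)
    rw [List.range_succ, List.map_append, losslessRun_append_iff]
    refine ⟨_, ih (fun k hk => hU k (hk.trans K.lt_succ_self)) h3,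
      losslessRun_singleton_iff.2 (LosslessStep.symm ?_)⟩
    have hK := hU K K.lt_succ_self
    have hv : Vanishes b (I K) ((U K)ᴴ * evolve b I U a K * U K) := by
      apply vanishes_of_frobSq_annihilate_eq
      rw [frobSq_conj hK.unitary, h3, ← h, evolve]
    rw [evolve, hv.annihilate_eq]
    refine ⟨hv, (U K)ᴴ, hK.conjTranspose, ?_⟩
    rw [Matrix.conjTranspose_conjTranspose, conj_conj_of_unitary hK.unitary]

/-- The elementary unitary matrices whose pivot diagonal blocks have determinants bounded from
below in modulus. For positive bounds, they form a compact set of regular matrices. -/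
def regularSet (b : N → ι) (p : ι × ι) (δ : ι → ℝ) : Set (Matrix N N ℂ) :=
  {U | IsElementary b p U ∧ ∀ r ∈ pivotSet p, δ r ≤ ‖(diagBlock b U r).det‖}

lemma isRegular_of_mem_regularSet {p : ι × ι} {δ : ι → ℝ} (hδ : ∀ r, 0 < δ r)
    {U : Matrix N N ℂ} (h : U ∈ regularSet b p δ) : IsRegular b p U :=
  ⟨h.1, fun r hr => norm_pos_iff.1 ((hδ r).trans_le (h.2 r hr))⟩

lemma isCompact_regularSet (b : N → ι) (p : ι × ι) (δ : ι → ℝ) :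
    IsCompact (regularSet b p δ) := by
  refine isCompact_of_isClosed_of_norm_le ?_ fun U hU x y =>
    entry_norm_bound_of_unitary hU.1.unitary x y
  have hset : regularSet b p δ =
      {U | star U * U = 1} ∩
      ((⋂ x, ⋂ y, ⋂ _ : ¬(b x ∈ pivotSet p ∧ b y ∈ pivotSet p),
        {U | U x y = (1 : Matrix N N ℂ) x y}) ∩
      ⋂ r ∈ pivotSet p, {U | δ r ≤ ‖(diagBlock b U r).det‖}) := by
    ext U
    constructor
    · intro h
      refine ⟨Matrix.mem_unitaryGroup_iff'.1 h.1.unitary, ?_, ?_⟩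
      · exact Set.mem_iInter.2 fun x => Set.mem_iInter.2 fun y => Set.mem_iInter.2 fun hxy =>
          h.1.apply_eq x y hxy
      · exact Set.mem_iInter₂.2 fun r hr => h.2 r hr
    · rintro ⟨h1, h2, h3⟩
      refine ⟨⟨Matrix.mem_unitaryGroup_iff'.2 h1, fun x y hxy => ?_⟩, fun r hr => ?_⟩
      · exact Set.mem_iInter.1 (Set.mem_iInter.1 (Set.mem_iInter.1 h2 x) y) hxy
      · exact Set.mem_iInter₂.1 h3 r hr
  rw [hset]
  refine IsClosed.inter ?_ (IsClosed.inter ?_ ?_)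
  · exact isClosed_eq (continuous_id.matrix_conjTranspose.matrix_mul continuous_id)
      continuous_const
  · exact isClosed_iInter fun x => isClosed_iInter fun y => isClosed_iInter fun _ =>
      isClosed_eq (continuous_id.matrix_elem x y) continuous_const
  · exact isClosed_biInter fun r _ => isClosed_le continuous_const
      (continuous_id.matrix_submatrix _ _).matrix_det.norm

/-- Along a definite sequence of pivot pairs, the evolution is a contraction, with a constant that
is uniform in the transformation matrices: the norm of the result is a continuous function on a
compact set, and it is less than `1` at each point. -/
theorem exists_contraction {K : ℕ} (hI : Definite N ((List.range K).map I)) {δ : ℕ → ι → ℝ}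
    (hδ : ∀ k r, 0 < δ k r) (b : N → ι) :
    ∃ μ : ℝ, 0 ≤ μ ∧ μ < 1 ∧ ∀ (U : ℕ → Matrix N N ℂ) (a : Matrix N N ℂ),
      (∀ k < K, U k ∈ regularSet b (I k) (δ k)) → (∀ x y, b x = b y → a x y = 0) →
        frobSq (evolve b I U a K) ≤ μ * frobSq a := by
  set S : Set ((ℕ → Matrix N N ℂ) × Matrix N N ℂ) :=
    (Set.pi Set.univ fun k => if k < K then regularSet b (I k) (δ k) else {1}) ×ˢ
      {a | (∀ x y, b x = b y → a x y = 0) ∧ frobSq a = 1} with hS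
  have hcomp : IsCompact S := by
    refine (isCompact_univ_pi fun k => ?_).prod
      (isCompact_of_isClosed_of_norm_le (IsClosed.and ?_ ?_) fun a ha x y => ?_)
    · split_ifs
      · exact isCompact_regularSet _ _ _
      · exact isCompact_singleton
    · have : IsClosed (⋂ x, ⋂ y, ⋂ _ : b x = b y, {a : Matrix N N ℂ | a x y = 0}) :=
        isClosed_iInter fun x => isClosed_iInter fun y => isClosed_iInter fun _ =>
          isClosed_eq (continuous_id.matrix_elem x y) continuous_const
      convert this using 1
      ext a
      simp
    · exact isClosed_eq continuous_frobSq continuous_const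
    · have := norm_sq_apply_le_frobSq a x y
      rw [ha.2] at this
      exact (sq_le_one_iff₀ (norm_nonneg _)).1 this
  -- It suffices to treat matrices of norm `1` and sequences that are constant from step `K` on.
  have hscale : ∀ μ : ℝ, 0 ≤ μ → (∀ z ∈ S, frobSq (evolve b I z.1 z.2 K) ≤ μ) →
      ∀ (U : ℕ → Matrix N N ℂ) (a : Matrix N N ℂ),
        (∀ k < K, U k ∈ regularSet b (I k) (δ k)) → (∀ x y, b x = b y → a x y = 0) →
          frobSq (evolve b I U a K) ≤ μ * frobSq a := by
    intro μ hμ hz U a hU ha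
    rcases (frobSq_nonneg a).eq_or_lt with h0 | h0
    · have := frobSq_evolve_antitone (b := b) (I := I) (fun k hk => (hU k hk).1.unitary) a
        K.zero_le le_rfl
      change _ ≤ frobSq a at this
      rw [← h0] at this ⊢
      simpa using this
    · set c : ℝ := (√(frobSq a))⁻¹ with hc
      have hc2 : ‖(c : ℂ)‖ ^ 2 = (frobSq a)⁻¹ := by
        rw [Complex.norm_real, Real.norm_eq_abs, sq_abs, hc, inv_pow, Real.sq_sqrt h0.le]
      have := hz (fun k => if k < K then U k else 1, (c : ℂ) • a) ⟨fun k _ => ?_, ?_, ?_⟩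
      · rw [evolve_congr (V := U) (fun l hl => if_pos hl), evolve_smul, frobSq_smul, hc2] at this
        rwa [inv_mul_le_iff₀ h0, mul_comm] at this
      · by_cases hk : k < K
        · simpa [hk] using hU k hk
        · simp [hk]
      · intro x y hxy
        simp [ha x y hxy]
      · rw [frobSq_smul, hc2, inv_mul_cancel₀ h0.ne']
  rcases S.eq_empty_or_nonempty with hE | hne
  · exact ⟨0, le_rfl, one_pos, hscale 0 le_rfl (by simp [hE])⟩
  obtain ⟨⟨U, a⟩, hz, hmax⟩ := hcomp.exists_isMaxOn hne
    (continuous_frobSq.comp (continuous_evolve b I K)).continuousOn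
  refine ⟨_, frobSq_nonneg (evolve b I U a K), ?_, hscale _ (frobSq_nonneg _) fun z hz => hmax hz⟩
  obtain ⟨hU, ha, ha1⟩ := hz
  have hreg : ∀ k < K, IsRegular b (I k) (U k) := fun k hk => by
    have := hU k (Set.mem_univ k)
    simp only [if_pos hk] at this
    exact isRegular_of_mem_regularSet (hδ k) this
  have hle := frobSq_evolve_antitone (b := b) (I := I) (fun k hk => (hreg k hk).unitary) a
    K.zero_le le_rfl
  change _ ≤ frobSq a at hle
  rw [← ha1]
  refine lt_of_le_of_ne hle fun heq => ?_
  have h0 := hI b a _ ha (losslessRun_of_frobSq_evolve_eq hreg heq)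
  rw [h0, frobSq_zero] at ha1
  exact zero_ne_one ha1

end Contraction

/-! ### Cyclic strategies -/

section Cyclic

variable {m : ℕ} {O : List (Fin m × Fin m)} {I : ℕ → Fin m × Fin m}

lemma IsCyclicStrategy.map_range (h : IsCyclicStrategy O I) (k : ℕ) :
    (List.range (k * O.length)).map I = sweeps k O := by
  have h1 : (List.range O.length).map I = O := by
    refine List.ext_getElem (by simp) fun i hi hi' => ?_
    have := h i
    rw [Nat.mod_eq_of_lt hi', List.getElem?_eq_getElem hi', Option.some_inj] at this
    simp [this]
  have h2 : ∀ i, I (O.length + i) = I i := fun i => by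
    have := h (O.length + i)
    rw [Nat.add_mod_left, h i, Option.some_inj] at this
    exact this.symm
  induction k with
  | zero => simp [sweeps_zero]
  | succ k ih =>
    rw [Nat.succ_mul, Nat.add_comm, List.range_add, List.map_append, h1, List.map_map, sweeps_succ,
      ← ih]
    exact congrArg _ (List.map_congr_left fun i _ => h2 i)

lemma IsCyclicStrategy.mem (h : IsCyclicStrategy O I) (k : ℕ) : I k ∈ O :=
  List.mem_of_getElem? (h k)

lemma IsCyclicStrategy.exists_eq (h : IsCyclicStrategy O I) {p : Fin m × Fin m} (hp : p ∈ O) :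
    ∃ k < O.length, I k = p := by
  obtain ⟨k, hk, rfl⟩ := List.mem_iff_getElem.1 hp
  refine ⟨k, hk, ?_⟩
  have := h k
  rw [Nat.mod_eq_of_lt hk, List.getElem?_eq_getElem hk, Option.some_inj] at this
  exact this.symm

end Cyclic

/-! ### Smallest singular values and determinants -/

lemma pow_le_norm_det_of_le_sigmaMin {p : ℕ} {V : Matrix (Fin p) (Fin p) ℂ} {c : ℝ} (hc : 0 ≤ c)
    (h : c ≤ sigmaMin V) : c ^ p ≤ ‖V.det‖ := by
  have hdet : ‖V.det‖ = ∏ i ∈ Finset.range p, (Matrix.toEuclideanLin V).singularValues i := by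
    have h1 := (Matrix.toEuclideanLin V).normDet_eq_norm_det
    rw [(Matrix.toEuclideanLin V).normDet_eq_prod_singularValues, finrank_euclideanSpace_fin] at h1
    rw [h1, LinearMap.det_toLpLin]
  calc c ^ p = ∏ _i ∈ Finset.range p, c := by simp
    _ ≤ _ := Finset.prod_le_prod (fun _ _ => hc) fun i hi => h.trans
        ((Matrix.toEuclideanLin V).singularValues_antitone
          (Nat.le_sub_one_of_lt (Finset.mem_range.1 hi)))
    _ = _ := hdet.symm

lemma gammaBound_pos (p q : ℕ) : 0 < gammaBound p q := by
  refine lt_max_of_lt_right (div_pos one_pos (Real.sqrt_pos.2 ?_))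
  exact_mod_cast Nat.choose_pos (Nat.le_add_right p q)

/-! ### Jacobi steps as annihilators -/

section Steps

variable {n : ℕ} (π : Composition n)

/-- The members of block `r`, as listed by the embedding of the block. -/
noncomputable def blockEquiv (r : Fin π.length) :
    Fin (π.blocksFun r) ≃ {x : Fin n // π.index x = r} :=
  Equiv.ofBijective (fun k => ⟨π.embedding r k, π.index_embedding r k⟩)
    ⟨fun k l h => (π.embedding r).injective (Subtype.ext_iff.1 h), fun ⟨x, hx⟩ => by
      obtain ⟨k, hk⟩ := π.mem_range_embedding_iff'.2 hx.symm
      exact ⟨k, Subtype.ext hk⟩⟩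

lemma det_diagBlock_index (V : Matrix (Fin n) (Fin n) ℂ) (r : Fin π.length) :
    (diagBlock π.index V r).det = (block π V r r).det :=
  (Matrix.det_submatrix_equiv_self (blockEquiv π r) (diagBlock π.index V r)).symm

variable {π} {i j : Fin π.length} {U A B : Matrix (Fin n) (Fin n) ℂ}

lemma IsUnitaryElementary.isElementary (h : IsUnitaryElementary π i j U) :
    IsElementary π.index (i, j) U where
  unitary := h.unitary
  apply_eq x y hxy := by
    have := congrFun (congrFun (h.block_eq (π.index x) (π.index y) hxy) (π.invEmbedding x))
      (π.invEmbedding y)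
    rwa [block, block, Matrix.submatrix_apply, Matrix.submatrix_apply, π.embedding_comp_inv,
      π.embedding_comp_inv] at this

lemma IsUBCE.mem_regularSet {ϱ : ℝ} (hϱ : 0 ≤ ϱ) (h : IsUBCE π ϱ i j U) :
    U ∈ regularSet π.index (i, j) fun r =>
      (ϱ * gammaBound (π.blocksFun i) (π.blocksFun j)) ^ π.blocksFun r := by
  have h0 : 0 ≤ ϱ * gammaBound (π.blocksFun i) (π.blocksFun j) :=
    mul_nonneg hϱ (gammaBound_pos _ _).le
  refine ⟨h.toIsUnitaryElementary.isElementary, ?_⟩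
  rintro r (rfl | rfl)
  · rw [det_diagBlock_index]
    exact pow_le_norm_det_of_le_sigmaMin h0 h.le_sigmaMin
  · rw [det_diagBlock_index]
    exact pow_le_norm_det_of_le_sigmaMin h0 (h.sigmaMin_eq ▸ h.le_sigmaMin)

/-- After a step, the pivot submatrix is diagonal in the full matrix. -/
lemma IsJacobiStep.apply_eq_zero (h : IsJacobiStep π i j U A B) (hij : i ≠ j) {x y : Fin n}
    (hx : π.index x ∈ pivotSet (i, j)) (hy : π.index y ∈ pivotSet (i, j)) (hxy : x ≠ y) :
    B x y = 0 := by
  have hU := h.elementary.isElementary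
  set e : Fin (π.blocksFun i) ⊕ Fin (π.blocksFun j) → Fin n :=
    Sum.elim (π.embedding i) (π.embedding j) with he
  have hinj : Function.Injective e :=
    (π.embedding i).injective.sumElim (π.embedding j).injective fun k l hkl => hij <| by
      rw [← π.index_embedding i k, hkl, π.index_embedding]
  have hrange : ∀ z, π.index z ∈ pivotSet (i, j) ↔ z ∈ Set.range e := fun z => by
    rw [he, Set.Sum.elim_range, Set.mem_union, π.mem_range_embedding_iff',
      π.mem_range_embedding_iff']
    simp [eq_comm]
  have hpiv : ∀ M : Matrix (Fin n) (Fin n) ℂ, pivotSubmatrix π M i j = M.submatrix e e := by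
    intro M
    ext (s | s) (t | t) <;> rfl
  have hsum : ∀ f : Fin n → ℂ, (∀ z, π.index z ∉ pivotSet (i, j) → f z = 0) →
      ∑ z, f z = ∑ s, f (e s) := fun f hf =>
    (Fintype.sum_of_injective e hinj (fun s => f (e s)) f
      (fun z hz => hf z fun hz' => hz ((hrange z).1 hz')) fun _ => rfl).symm
  have hU0 : ∀ z y, π.index y ∈ pivotSet (i, j) → π.index z ∉ pivotSet (i, j) → U z y = 0 :=
    fun z y hy hz => by
      rw [hU.apply_eq z y fun h' => hz h'.1, Matrix.one_apply_ne]
      rintro rfl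
      exact hz hy
  have hd := h.diagonalizes
  rw [hpiv, hpiv] at hd
  obtain ⟨s, rfl⟩ := (hrange x).1 hx
  obtain ⟨t, rfl⟩ := (hrange y).1 hy
  have hst := hd (fun e' : s = t => hxy (congrArg e e'))
  rw [h.eq, ← hst, Matrix.mul_apply, Matrix.mul_apply, hsum]
  · refine Finset.sum_congr rfl fun w _ => ?_
    rw [Matrix.mul_apply, Matrix.mul_apply, hsum]
    · rfl
    · intro z hz
      rw [Matrix.conjTranspose_apply, hU0 z _ hx hz, star_zero, zero_mul]
  · intro w hw
    rw [hU0 w _ hy hw, mul_zero]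

/-- The part of `A` outside the diagonal blocks. -/
def offBlock (π : Composition n) (A : Matrix (Fin n) (Fin n) ℂ) : Matrix (Fin n) (Fin n) ℂ :=
  Matrix.of fun x y => if π.index x = π.index y then 0 else A x y

lemma offBlock_apply_of_eq (A : Matrix (Fin n) (Fin n) ℂ) {x y : Fin n}
    (h : π.index x = π.index y) : offBlock π A x y = 0 := if_pos h

lemma offBlock_apply_of_ne (A : Matrix (Fin n) (Fin n) ℂ) {x y : Fin n}
    (h : π.index x ≠ π.index y) : offBlock π A x y = A x y := if_neg h

/-- The part outside the diagonal blocks evolves autonomously: the diagonal blocks influence only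
the pivot submatrix, whose off-diagonal part is annihilated anyway. -/
lemma IsJacobiStep.offBlock_eq (h : IsJacobiStep π i j U A B) (hij : i ≠ j) :
    offBlock π B = annihilate π.index (i, j) (Uᴴ * offBlock π A * U) := by
  have hU := h.elementary.isElementary
  ext x y
  by_cases hk : Kept π.index (i, j) x y
  · rw [annihilate_apply_of_kept hk, offBlock_apply_of_ne _ hk.1, h.eq]
    set D := A - offBlock π A with hD
    have hD0 : ∀ z w, π.index z ≠ π.index w → D z w = 0 := fun z w hzw => by
      rw [hD, Matrix.sub_apply, offBlock_apply_of_ne _ hzw, sub_self]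
    have hDU : (Uᴴ * D * U) x y = 0 := by
      by_cases hy : π.index y ∈ pivotSet (i, j)
      · have hx : π.index x ∉ pivotSet (i, j) := fun hx => hk.2 ⟨hx, hy⟩
        rw [Matrix.mul_assoc, hU.conjTranspose_mul_apply_of_notMem _ _ hx, Matrix.mul_apply]
        refine Finset.sum_eq_zero fun z _ => ?_
        by_cases hz : π.index x = π.index z
        · rw [hU.apply_eq z y fun h' => hx (hz ▸ h'.1), Matrix.one_apply_ne, mul_zero]
          rintro rfl
          exact hk.1 hz
        · rw [hD0 x z hz, zero_mul]
      · rw [hU.mul_apply_of_notMem _ _ hy, Matrix.mul_apply]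
        refine Finset.sum_eq_zero fun z _ => ?_
        by_cases hz : π.index z = π.index y
        · rw [hU.conjTranspose.apply_eq x z fun h' => hy (hz ▸ h'.2), Matrix.one_apply_ne, zero_mul]
          rintro rfl
          exact hk.1 hz
        · rw [hD0 z y hz, mul_zero]
    have hA : A = offBlock π A + D := by rw [hD]; abel
    conv_lhs => rw [hA, Matrix.mul_add, Matrix.add_mul, Matrix.add_apply, hDU, add_zero]
  · rw [annihilate_apply_of_not_kept hk]
    by_cases hxy : π.index x = π.index y
    · exact offBlock_apply_of_eq _ hxy
    · rw [offBlock_apply_of_ne _ hxy]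
      have : π.index x ∈ pivotSet (i, j) ∧ π.index y ∈ pivotSet (i, j) := by
        by_contra hne
        exact hk ⟨hxy, hne⟩
      exact h.apply_eq_zero hij this.1 this.2 fun e => hxy (congrArg _ e)

lemma offBlock_eq_evolve {I : ℕ → Fin π.length × Fin π.length} {K : ℕ}
    {A U : ℕ → Matrix (Fin n) (Fin n) ℂ} (hI : ∀ k, (I k).1 ≠ (I k).2)
    (h : ∀ k < K, IsJacobiStep π (I k).1 (I k).2 (U k) (A k) (A (k + 1))) :
    ∀ k ≤ K, offBlock π (A k) = evolve π.index I U (offBlock π (A 0)) k := by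
  intro k hk
  induction k with
  | zero => rfl
  | succ k ih => rw [(h k hk).offBlock_eq (hI k), ih (Nat.le_of_succ_le hk), evolve]

/-- A diagonal block becomes diagonal when it is first used, and it remains so. -/
lemma apply_eq_zero_of_used {I : ℕ → Fin π.length × Fin π.length} {K : ℕ}
    {A U : ℕ → Matrix (Fin n) (Fin n) ℂ} (hI : ∀ k, (I k).1 ≠ (I k).2)
    (h : ∀ k < K, IsJacobiStep π (I k).1 (I k).2 (U k) (A k) (A (k + 1)))
    {k l : ℕ} (hkl : k < l) (hl : l ≤ K) {x y : Fin n} (hxy : x ≠ y)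
    (hb : π.index x = π.index y) (hk : π.index x ∈ pivotSet (I k)) : A l x y = 0 := by
  induction l, hkl using Nat.le_induction with
  | base => exact (h k hl).apply_eq_zero (hI k) hk (hb ▸ hk) hxy
  | succ l _ ih =>
    have hs := h l hl
    by_cases hx : π.index x ∈ pivotSet (I l)
    · exact hs.apply_eq_zero (hI l) hx (hb ▸ hx) hxy
    · rw [hs.eq, hs.elementary.isElementary.conj_apply_of_notMem _ hx (hb ▸ hx)]
      exact ih (l.le_succ.trans hl)

open scoped Matrix.Norms.Frobenius in
lemma sq_off (A : Matrix (Fin n) (Fin n) ℂ) :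
    off A ^ 2 = frobSq (A - Matrix.diagonal A.diag) := by
  have h : off A = √(frobSq (A - Matrix.diagonal A.diag)) := by
    rw [off, Matrix.frobenius_norm_def, ← Real.sqrt_eq_rpow, frobSq]
    simp only [Real.rpow_two]
  rw [h, Real.sq_sqrt (frobSq_nonneg _)]

lemma off_nonneg (A : Matrix (Fin n) (Fin n) ℂ) : 0 ≤ off A :=
  letI := Matrix.frobeniusNormedAddCommGroup (m := Fin n) (n := Fin n) (α := ℂ)
  norm_nonneg (A - Matrix.diagonal A.diag)

lemma frobSq_offBlock_le (A : Matrix (Fin n) (Fin n) ℂ) : frobSq (offBlock π A) ≤ off A ^ 2 := by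
  rw [sq_off]
  refine frobSq_mono fun x y => ?_
  by_cases hxy : π.index x = π.index y
  · rw [offBlock_apply_of_eq _ hxy, norm_zero]
    exact norm_nonneg _
  · rw [offBlock_apply_of_ne _ hxy, Matrix.sub_apply,
      Matrix.diagonal_apply_ne _ fun e => hxy (congrArg _ e), sub_zero]

lemma sq_off_eq_frobSq_offBlock {A : Matrix (Fin n) (Fin n) ℂ}
    (h : ∀ x y, x ≠ y → π.index x = π.index y → A x y = 0) :
    off A ^ 2 = frobSq (offBlock π A) := by
  rw [sq_off]
  congr 1
  ext x y
  by_cases hxy : x = y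
  · subst hxy
    rw [offBlock_apply_of_eq _ rfl, Matrix.sub_apply, Matrix.diagonal_apply_eq, Matrix.diag_apply,
      sub_self]
  · rw [Matrix.sub_apply, Matrix.diagonal_apply_ne _ hxy, sub_zero]
    by_cases hb : π.index x = π.index y
    · rw [offBlock_apply_of_eq _ hb, h x y hxy hb]
    · rw [offBlock_apply_of_ne _ hb]

end Steps

/-! ### The contraction constant -/

/-- The contraction constant of an ordering. The number `d` of shifts in a chain is not bounded,
but the least possible `d` yields a constant that serves for all the others, since the norm does
not increase in further sweeps. -/
lemma exists_constant_of_ordering {n : ℕ} {ϱ : ℝ} (hϱ : 0 < ϱ) (π : Composition n)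
    (hπ : 2 ≤ π.length) (O : List (Fin π.length × Fin π.length)) :
    ∃ μ : ℝ, 0 ≤ μ ∧ μ < 1 ∧ ∀ d, GeneralizedSerialWith d O →
      ∀ I, IsCyclicStrategy O I → ∀ A U : ℕ → Matrix (Fin n) (Fin n) ℂ,
        (∀ k < (d + 1) * O.length, IsJacobiStep π (I k).1 (I k).2 (U k) (A k) (A (k + 1))) →
        (∀ k < (d + 1) * O.length, IsUBCE π ϱ (I k).1 (I k).2 (U k)) →
        off (A ((d + 1) * O.length)) ≤ μ * off (A 0) := by
  classical
  by_cases hex : ∃ d I, GeneralizedSerialWith d O ∧ IsCyclicStrategy O I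
  swap
  · exact ⟨0, le_rfl, one_pos, fun d hd I hI => absurd ⟨d, I, hd, hI⟩ hex⟩
  have hex' : ∃ d, GeneralizedSerialWith d O := ⟨hex.choose, hex.choose_spec.choose_spec.1⟩
  obtain ⟨-, I, -, hI⟩ := hex
  set d₀ := Nat.find hex'
  have hd₀ : GeneralizedSerialWith d₀ O := Nat.find_spec hex'
  have hO : IsPivotOrdering O := hd₀.1
  have hne : ∀ k, (I k).1 ≠ (I k).2 := fun k => ((hO.mem_iff _).1 (hI.mem k)).ne
  set δ : ℕ → Fin π.length → ℝ := fun k r =>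
    (ϱ * gammaBound (π.blocksFun (I k).1) (π.blocksFun (I k).2)) ^ π.blocksFun r
  have hδ : ∀ k r, 0 < δ k r := fun k r => pow_pos (mul_pos hϱ (gammaBound_pos _ _)) _
  obtain ⟨μ, hμ0, hμ1, hμ⟩ := exists_contraction (K := (d₀ + 1) * O.length)
    (hI.map_range (d₀ + 1) ▸ hd₀.definite_sweeps (N := Fin n)) hδ π.index
  refine ⟨√μ, Real.sqrt_nonneg _, by rwa [Real.sqrt_lt' one_pos, one_pow], ?_⟩
  intro d hd I' hI' A U hstep hU
  obtain rfl : I' = I := funext fun k => Option.some_inj.1 ((hI' k).symm.trans (hI k))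
  have hle : (d₀ + 1) * O.length ≤ (d + 1) * O.length :=
    Nat.mul_le_mul_right _ (Nat.succ_le_succ (Nat.find_min' hex' hd))
  set K := (d + 1) * O.length
  have hdiag : ∀ x y, x ≠ y → π.index x = π.index y → A K x y = 0 := by
    intro x y hxy hb
    -- As there are at least two blocks, each of them occurs in some pivot pair.
    obtain ⟨p, hp, hxp⟩ : ∃ p ∈ O, π.index x ∈ pivotSet p := by
      have : Nontrivial (Fin π.length) := Fin.nontrivial_iff_two_le.2 hπ
      obtain ⟨s, hs⟩ := exists_ne (π.index x)
      rcases lt_or_gt_of_ne hs with h | h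
      · exact ⟨(s, π.index x), (hO.mem_iff _).2 h, by simp⟩
      · exact ⟨(π.index x, s), (hO.mem_iff _).2 h, by simp⟩
    obtain ⟨k, hk, rfl⟩ := hI.exists_eq hp
    exact apply_eq_zero_of_used hne hstep
      (hk.trans_le (Nat.le_mul_of_pos_left _ d.succ_pos)) le_rfl hxy hb hxp
  have hmem : ∀ k < K, U k ∈ regularSet π.index (I' k) (δ k) := fun k hk =>
    (hU k hk).mem_regularSet hϱ.le
  have hsq : off (A K) ^ 2 ≤ (√μ * off (A 0)) ^ 2 := by
    calc off (A K) ^ 2 = frobSq (evolve π.index I' U (offBlock π (A 0)) K) := by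
          rw [sq_off_eq_frobSq_offBlock hdiag, offBlock_eq_evolve hne hstep K le_rfl]
      _ ≤ frobSq (evolve π.index I' U (offBlock π (A 0)) ((d₀ + 1) * O.length)) :=
          frobSq_evolve_antitone (fun k hk => (hmem k hk).1.unitary) _ hle le_rfl
      _ ≤ μ * frobSq (offBlock π (A 0)) :=
          hμ U _ (fun k hk => hmem k (hk.trans_le hle)) fun x y hxy => offBlock_apply_of_eq _ hxy
      _ ≤ μ * off (A 0) ^ 2 := mul_le_mul_of_nonneg_left (frobSq_offBlock_le _) hμ0
      _ = (√μ * off (A 0)) ^ 2 := by rw [mul_pow, Real.sq_sqrt hμ0]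
  exact le_of_sq_le_sq hsq (mul_nonneg (Real.sqrt_nonneg _) (off_nonneg _))

/-- There are finitely many pivot orderings, so that the constant can be chosen independently of
the ordering. -/
lemma exists_constant_of_composition {n : ℕ} {ϱ : ℝ} (hϱ : 0 < ϱ) (π : Composition n)
    (hπ : 2 ≤ π.length) :
    ∃ μ : ℝ, 0 ≤ μ ∧ μ < 1 ∧ ∀ d O, GeneralizedSerialWith d O →
      ∀ I, IsCyclicStrategy O I → ∀ A U : ℕ → Matrix (Fin n) (Fin n) ℂ,
        (∀ k < (d + 1) * O.length, IsJacobiStep π (I k).1 (I k).2 (U k) (A k) (A (k + 1))) →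
        (∀ k < (d + 1) * O.length, IsUBCE π ϱ (I k).1 (I k).2 (U k)) →
        off (A ((d + 1) * O.length)) ≤ μ * off (A 0) := by
  choose f hf0 hf1 hf using exists_constant_of_ordering hϱ π hπ
  have : Nonempty {O : List (Fin π.length × Fin π.length) // O.Nodup} := ⟨⟨[], List.nodup_nil⟩⟩
  obtain ⟨O₀, hO₀⟩ := Finite.exists_max
    fun O : {O : List (Fin π.length × Fin π.length) // O.Nodup} => f O
  refine ⟨f O₀, hf0 _, hf1 _, fun d O hO I hI A U h1 h2 => (hf O d hO I hI A U h1 h2).trans ?_⟩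
  exact mul_le_mul_of_nonneg_right (hO₀ ⟨O, hO.1.nodup⟩) (off_nonneg _)

end BlockJacobi

theorem mainTheorem2 (n : ℕ) (ϱ : ℝ) (hϱ_pos : 0 < ϱ) (hϱ_le : ϱ ≤ 1) :
    ∃ μn : ℝ, μn < 1 ∧
      ∀ π : Composition n, 2 ≤ π.length →
        ∃ μ : ℝ, 0 ≤ μ ∧ μ < μn ∧
          ∀ (d : ℕ) (O : List (Fin π.length × Fin π.length)),
            BlockJacobi.GeneralizedSerialWith d O →
            ∀ I : ℕ → Fin π.length × Fin π.length, BlockJacobi.IsCyclicStrategy O I →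
            ∀ A U : ℕ → Matrix (Fin n) (Fin n) ℂ, (A 0).IsHermitian →
              (∀ k < (d + 1) * O.length,
                BlockJacobi.IsJacobiStep π (I k).1 (I k).2 (U k) (A k) (A (k + 1))) →
              (∀ k < (d + 1) * O.length, BlockJacobi.IsUBCE π ϱ (I k).1 (I k).2 (U k)) →
              BlockJacobi.off (A ((d + 1) * O.length)) ≤ μ * BlockJacobi.off (A 0) := by
  have key : ∀ π : Composition n, ∃ μ : ℝ, μ < 1 ∧ (2 ≤ π.length → 0 ≤ μ ∧
      ∀ d O, BlockJacobi.GeneralizedSerialWith d O →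
      ∀ I, BlockJacobi.IsCyclicStrategy O I → ∀ A U : ℕ → Matrix (Fin n) (Fin n) ℂ,
        (∀ k < (d + 1) * O.length,
          BlockJacobi.IsJacobiStep π (I k).1 (I k).2 (U k) (A k) (A (k + 1))) →
        (∀ k < (d + 1) * O.length, BlockJacobi.IsUBCE π ϱ (I k).1 (I k).2 (U k)) →
        BlockJacobi.off (A ((d + 1) * O.length)) ≤ μ * BlockJacobi.off (A 0)) := fun π => by
    by_cases hπ : 2 ≤ π.length
    · obtain ⟨μ, h0, h1, h⟩ := BlockJacobi.exists_constant_of_composition hϱ_pos π hπ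
      exact ⟨μ, h1, fun _ => ⟨h0, h⟩⟩
    · exact ⟨0, one_pos, fun h => absurd h hπ⟩
  choose f hf1 hf using key
  have : Nonempty (Composition n) := ⟨Composition.ones n⟩
  obtain ⟨π₀, hπ₀⟩ := Finite.exists_max f
  refine ⟨(f π₀ + 1) / 2, by linarith [hf1 π₀], fun π hπ => ⟨f π, (hf π hπ).1, ?_, ?_⟩⟩
  · linarith [hπ₀ π, hf1 π₀]
  · exact fun d O hO I hI A U _ => (hf π hπ).2 d O hO I hI A U
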